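/- Let $d>2$ be an integer and $\beta>0$. There exists $\delta=\delta(d,\beta)>0$ with the following property. Let $\lambda>0$, let $\Phi=\{z_i\}$ be a homogeneous Poisson point process on $\mathbb R^d$ with intensity $\lambda$, and let the marks $\{\rho_i\}_{z_i\in\Phi}\subset[0,\infty)$ be i.i.d. random variables, independent of $\Phi$, with $\langle\rho^{\,d-2+\beta}\rangle<\infty$. Let $D\subset\mathbb R^d$ be open, bounded and star-shaped with respect to the origin. For $\varepsilon>0$ set $$\Phi^\varepsilon(D)=\Phi\cap\tfrac1\varepsilon D,\qquad H^\varepsilon=\bigcup_{z_i\in\Phi^\varepsilon(D)}B_{\varepsilon^{\frac d{d-2}}\rho_i}(\varepsilon z_i),$$ where $B_r(x)$ is the open ball, and for $\eta>0$ let $\Phi^\varepsilon_{\eta}(D)$ be the set of those $z\in\Phi^\varepsilon(D)$ with $|z-y|\ge\eta$ for all $y\in\Phi$, $y\ne z$. Then almost surely there are $\varepsilon_0=\varepsilon_0(\omega)>0$ and, for every $\varepsilon\in(0,\varepsilon_0]$, a partition into disjoint sets $H^\varepsilon=H^\varepsilon_g\cup H^\varepsilon_b$, a subset $n^\varepsilon\subset\Phi^\varepsilon(D)$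 and a measurable set $D^\varepsilon_b\subset\mathbb R^d$ with $H^\varepsilon_b\subset D^\varepsilon_b$, such that for all $\varepsilon\in(0,\varepsilon_0]$ $$H^\varepsilon_g=\bigcup_{z_i\in n^\varepsilon}B_{\varepsilon^{\frac d{d-2}}\rho_i}(\varepsilon z_i),\qquad H^\varepsilon_b=\bigcup_{z_i\in\Phi^\varepsilon(D)\setminus n^\varepsilon}B_{\varepsilon^{\frac d{d-2}}\rho_i}(\varepsilon z_i),\qquad \operatorname{dist}(H^\varepsilon_g,D^\varepsilon_b)>\varepsilon^{1+\delta},$$ the balls in the union for $H^\varepsilon_g$ are pairwise disjoint, and $$\varepsilon|z_i-z_j|\ge2\varepsilon^{1+\frac\delta2}\quad\text{for all }z_i\ne z_j\in n^\varepsilon,\qquad \varepsilon^{\frac d{d-2}}\rho_i\le\varepsilon^{1+2\delta}\quad\text{for all }z_i\in n^\varepsilon,$$ and such that, as $\varepsilon\downarrow0$, $$|D^\varepsilon_b|\to0,\qquad \varepsilon^d\,\#n^\varepsilon\to\lambda|D|,$$ and, for every $\eta>0$, $$\lim_{\varepsilon\downarrow0}\varepsilon^d\,\#\bigl\{z_i\in\Phi^\varepsilon_{2\eta}(D):\operatorname{dist}(\varepsilon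 z_i,D^\varepsilon_b)\le\eta\varepsilon\bigr\}=0.$$ Here the distance to the empty set is $+\infty$. -/

import Mathlib

open MeasureTheory ProbabilityTheory Filter Topology Set
open scoped ENNReal NNReal Pointwise

/-- The space `ℝ^d` with its Euclidean norm and Lebesgue measure. -/
abbrev Rd (d : ℕ) : Type := EuclideanSpace ℝ (Fin d)

/-- The marked point process `(Φ, R)` in `ℝ^d`: `Φ = {z 0, z 1, …}` is a homogeneous Poisson point
process of intensity `lam` (listed in some measurable way, without repetitions), and the radius
`ρ i` is attached to the point `z i`. The radii are nonnegative, i.i.d., and independent of the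
points. (As `lam > 0`, the process almost surely has infinitely many points, so that it is listed
by all of `ℕ`.) -/
structure IsMarkedPoissonProcess {d : ℕ} {Ω : Type*} [MeasurableSpace Ω] (P : Measure Ω)
    (lam : ℝ) (z : ℕ → Ω → Rd d) (ρ : ℕ → Ω → ℝ) : Prop where
  /-- the points are random variables -/
  measurable_point : ∀ i, Measurable (z i)
  /-- the radii are random variables -/
  measurable_radius : ∀ i, Measurable (ρ i)
  /-- no point is listed twice -/
  injective : ∀ᵐ ω ∂P, Function.Injective fun i => z i ω
  /-- only finitely many points lie in a bounded region -/
  locallyFinite : ∀ᵐ ω ∂P, ∀ r : ℝ, {i | z i ω ∈ Metric.ball (0 : Rd d) r}.Finite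
  /-- the number of points in a bounded Borel set `A` is Poisson distributed with mean `lam |A|` -/
  poisson_count : ∀ A : Set (Rd d), MeasurableSet A → Bornology.IsBounded A →
    HasLaw (fun ω => {i | z i ω ∈ A}.ncard)
      (poissonMeasure (lam * (volume : Measure (Rd d)).real A).toNNReal) P
  /-- the numbers of points in disjoint bounded Borel sets are independent -/
  indep_count : ∀ A : ℕ → Set (Rd d), (∀ k, MeasurableSet (A k)) →
    (∀ k, Bornology.IsBounded (A k)) → Pairwise (fun k l => Disjoint (A k) (A l)) →
    iIndepFun (fun k ω => {i | z i ω ∈ A k}.ncard) P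
  /-- the radii are nonnegative -/
  radius_nonneg : ∀ i, ∀ᵐ ω ∂P, 0 ≤ ρ i ω
  /-- the radii are independent of each other -/
  indep_radius : iIndepFun ρ P
  /-- the radii are identically distributed -/
  identDistrib_radius : ∀ i, IdentDistrib (ρ i) (ρ 0) P P
  /-- the family of radii is independent of the family of points -/
  indep_point_radius : IndepFun (fun ω i => z i ω) (fun ω i => ρ i ω) P

/-- `Φ^ε(D) = Φ ∩ ε⁻¹ D`, as a set of labels; `z` is one realization of the points. -/
def pointsIn {d : ℕ} (z : ℕ → Rd d) (D : Set (Rd d)) (ε : ℝ) : Set ℕ :=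
  {i | z i ∈ ε⁻¹ • D}

/-- `Φ_η^ε(D) = Φ_η ∩ ε⁻¹ D`, as a set of labels, where `Φ_η` is the thinned process of those
points of `Φ` whose distance from all the other points of `Φ` is at least `η`. -/
def thinnedPointsIn {d : ℕ} (z : ℕ → Rd d) (D : Set (Rd d)) (η ε : ℝ) : Set ℕ :=
  {i | i ∈ pointsIn z D ε ∧ ∀ j, j ≠ i → η ≤ dist (z i) (z j)}

/-- The rescaled radius `ε^{d/(d-2)} r` of a hole. -/
noncomputable def holeRadius (d : ℕ) (ε r : ℝ) : ℝ :=
  ε ^ ((d : ℝ) / ((d : ℝ) - 2)) * r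

/-- The hole `B_{ε^{d/(d-2)} ρ_i}(ε z_i)` generated by the `i`-th point. -/
noncomputable def hole {d : ℕ} (z : ℕ → Rd d) (ρ : ℕ → ℝ) (ε : ℝ) (i : ℕ) : Set (Rd d) :=
  Metric.ball (ε • z i) (holeRadius d ε (ρ i))

/-- The set `H^ε` of all the holes, generated by the points of `Φ^ε(D)`. -/
noncomputable def holes {d : ℕ} (z : ℕ → Rd d) (ρ : ℕ → ℝ) (D : Set (Rd d)) (ε : ℝ) :
    Set (Rd d) :=
  ⋃ i ∈ pointsIn z D ε, hole z ρ ε i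

/-- The distance `inf {|x - y| : x ∈ A, y ∈ B}` of two sets (`+∞` if one of them is empty). -/
noncomputable def setEDist {d : ℕ} (A B : Set (Rd d)) : ℝ≥0∞ :=
  ⨅ x ∈ A, ⨅ y ∈ B, edist x y

/-!
A point of `Φ^ε(D)` is called good if its hole has radius at most `ε ^ (1 + 2 δ)` and if the hole of
every other point `z j` stays at distance at least `2 ε ^ (1 + δ / 2)` from `ε z i`. With the
remaining holes as the bad ones, and with the bad set `Hb` itself as the safety layer, the geometric
properties are consequences of the triangle inequality. The probabilistic content is that few points
are bad, and it rests on three almost sure facts, with `p ∈ (d - 2, d]` such that the radii have a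
finite moment of order `p`.

* `IsMarkedPoissonProcess.ae_tendsto_ncard_pointsIn`: the law of large numbers
  `ε ^ d * #Φ^ε(D) → lam * |D|`. By Chebyshev's inequality it holds along `ε = 1 / m`, and the
  star-shapedness of `D` makes the number of points monotone in `ε`.
* `IsMarkedPoissonProcess.ae_tendsto_tsum_radius`: `ε ^ (d + κ) * ∑ ρ_i ^ p → 0` for every `κ > 0`.
  As `p * d / (d - 2) > d`, the sum of the `p`-th powers of the rescaled radii tends to zero. Hence
  all the rescaled radii are eventually at most one, the volume of the holes vanishes, and for
  `δ < 1 / (d - 2)` only `o(ε ^ (-d))` holes have a radius above `ε ^ (1 + 2 δ)`.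
* `IsMarkedPoissonProcess.ae_tendsto_closePairs`: there are only `o(ε ^ (-d))` pairs of points whose
  distance is below `3 ε ^ (δ / 2)` plus four times the radius of the hole of one of them, divided
  by `ε`. A bad point with a small radius belongs to such a pair, and so does a point that has no
  other point within `2 η` but lies close to the bad hole of another point.

The last two facts have first moments with a power of `ε` to spare, so that Borel–Cantelli along
`ε = 2 ^ (-k)`, with monotone majorants in between, suffices. The expected number of close pairs is
bounded by covering with overlapping cubes, in which the number of ordered pairs has the second
factorial moment of a Poisson variable (`IsMarkedPoissonProcess.tsum_measure_dist_lt_le`), and then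
integrating over the radii, which are independent of the points.
-/

/-! ### Moments of the Poisson distribution -/

lemma hasSum_poisson_mul_descFactorial (r : ℝ≥0) (k : ℕ) :
    HasSum (fun n : ℕ => Real.exp (-r) * r ^ n / n.factorial * (n.descFactorial k : ℝ))
      ((r : ℝ) ^ k) := by
  rw [← hasSum_nat_add_iff' k]
  have h0 : ∑ i ∈ Finset.range k,
      Real.exp (-r) * (r : ℝ) ^ i / i.factorial * (i.descFactorial k : ℝ) = 0 := by
    refine Finset.sum_eq_zero fun i hi => ?_
    rw [Nat.descFactorial_eq_zero_iff_lt.2 (Finset.mem_range.1 hi)]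
    simp
  rw [h0, sub_zero]
  have := (hasSum_one_poissonMeasure r).mul_left ((r : ℝ) ^ k)
  rw [mul_one] at this
  refine this.congr_fun fun n => ?_
  have h1 := Nat.factorial_mul_descFactorial (Nat.le_add_left k n)
  rw [Nat.add_sub_cancel] at h1
  have h2 : ((n + k).factorial : ℝ) = n.factorial * ((n + k).descFactorial k : ℝ) := by
    exact_mod_cast h1.symm
  have h3 : ((n + k).descFactorial k : ℝ) ≠ 0 := by
    intro h
    rw [h, mul_zero] at h2
    exact (Nat.cast_ne_zero.2 (Nat.factorial_ne_zero _)) h2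
  have h4 : (n.factorial : ℝ) ≠ 0 := Nat.cast_ne_zero.2 (Nat.factorial_ne_zero _)
  rw [h2]
  field_simp
  ring

lemma lintegral_poissonMeasure_of_hasSum {r : ℝ≥0} {f : ℕ → ℝ} {a : ℝ} (hf : ∀ n, 0 ≤ f n)
    (h : HasSum (fun n : ℕ => Real.exp (-r) * r ^ n / n.factorial * f n) a) :
    ∫⁻ n, ENNReal.ofReal (f n) ∂(poissonMeasure r) = ENNReal.ofReal a := by
  rw [poissonMeasure, lintegral_sum_measure, ← h.tsum_eq,
    ENNReal.ofReal_tsum_of_nonneg (fun n => by have := hf n; positivity) h.summable]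
  refine tsum_congr fun n => ?_
  rw [lintegral_smul_measure, lintegral_dirac, smul_eq_mul, ENNReal.ofReal_mul (by positivity)]

lemma lintegral_poissonMeasure_descFactorial (r : ℝ≥0) (k : ℕ) :
    ∫⁻ n : ℕ, (n.descFactorial k : ℝ≥0∞) ∂(poissonMeasure r) = (r : ℝ≥0∞) ^ k := by
  have h := lintegral_poissonMeasure_of_hasSum (f := fun n => (n.descFactorial k : ℝ))
    (fun n => by positivity) (hasSum_poisson_mul_descFactorial r k)
  simp only [ENNReal.ofReal_natCast] at h
  rw [h, ENNReal.ofReal_pow r.coe_nonneg, ENNReal.ofReal_coe_nnreal]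

/-- The variance of the Poisson distribution is its mean. -/
lemma lintegral_poissonMeasure_sq_sub (r : ℝ≥0) :
    ∫⁻ n : ℕ, ENNReal.ofReal (((n : ℝ) - r) ^ 2) ∂(poissonMeasure r) = r := by
  have h0 := hasSum_poisson_mul_descFactorial r 0
  have h1 := hasSum_poisson_mul_descFactorial r 1
  have h2 := hasSum_poisson_mul_descFactorial r 2
  have h := (h2.add (h1.mul_left (1 - 2 * (r : ℝ)))).add (h0.mul_left ((r : ℝ) ^ 2))
  have e : (r : ℝ) ^ 2 + (1 - 2 * (r : ℝ)) * r ^ 1 + r ^ 2 * r ^ 0 = r := by ring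
  rw [e] at h
  rw [lintegral_poissonMeasure_of_hasSum (a := r) (fun n => sq_nonneg _),
    ENNReal.ofReal_coe_nnreal]
  refine h.congr_fun fun n => ?_
  have : (n.descFactorial 2 : ℝ) = n * (n - 1) := by
    rcases n with _ | n
    · simp
    · simp [Nat.descFactorial]; ring
  rw [this, Nat.descFactorial_one, Nat.descFactorial_zero]
  push_cast
  ring

/-! ### Counting -/

lemma tsum_indicator_one_eq_encard {ι : Type*} (s : Set ι) :
    ∑' i, s.indicator (fun _ => (1 : ℝ≥0∞)) i = (s.encard : ℝ≥0∞) := by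
  rw [← tsum_subtype, ENNReal.tsum_set_one]

lemma measurable_encard_setOf {ι Ω : Type*} [Countable ι] [MeasurableSpace Ω] {S : ι → Set Ω}
    (hS : ∀ i, MeasurableSet (S i)) :
    Measurable fun ω => (({i | ω ∈ S i}.encard : ℕ∞) : ℝ≥0∞) := by
  simp_rw [← tsum_indicator_one_eq_encard]
  refine Measurable.tsum fun i => ?_
  exact (measurable_const.indicator (hS i) : Measurable ((S i).indicator fun _ => (1 : ℝ≥0∞)))

/-- The expected number of events that occur is the sum of their probabilities. -/
lemma lintegral_encard_setOf {ι Ω : Type*} [Countable ι] [MeasurableSpace Ω] (P : Measure Ω)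
    {S : ι → Set Ω} (hS : ∀ i, MeasurableSet (S i)) :
    ∫⁻ ω, (({i | ω ∈ S i}.encard : ℕ∞) : ℝ≥0∞) ∂P = ∑' i, P (S i) := by
  simp_rw [← tsum_indicator_one_eq_encard]
  have h : ∀ i ω, {i | ω ∈ S i}.indicator (fun _ => (1 : ℝ≥0∞)) i =
      (S i).indicator (fun _ => (1 : ℝ≥0∞)) ω := fun i ω => rfl
  simp_rw [h]
  rw [lintegral_tsum fun i => (measurable_const.indicator (hS i)).aemeasurable]
  simp [lintegral_indicator, hS]

lemma encard_offDiag_of_finite {ι : Type*} {s : Set ι} (hs : s.Finite) :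
    s.offDiag.encard = (s.ncard.descFactorial 2 : ℕ) := by
  classical
  lift s to Finset ι using hs
  rw [← Finset.coe_offDiag, Set.encard_coe_eq_coe_finsetCard, Finset.offDiag_card,
    Set.ncard_coe_finset]
  congr 1
  simp [Nat.descFactorial, mul_comm, Nat.mul_sub]

/-! ### Counting the points of the process -/

section Counts

variable {d : ℕ} {Ω : Type*} [MeasurableSpace Ω] {P : Measure Ω} {lam : ℝ}
  {z : ℕ → Ω → Rd d} {ρ : ℕ → Ω → ℝ}

lemma IsMarkedPoissonProcess.ae_finite (h : IsMarkedPoissonProcess P lam z ρ) :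
    ∀ᵐ ω ∂P, ∀ A : Set (Rd d), Bornology.IsBounded A → {i | z i ω ∈ A}.Finite := by
  filter_upwards [h.locallyFinite] with ω hω A hA
  obtain ⟨r, hr⟩ := hA.subset_ball (0 : Rd d)
  exact (hω r).subset fun i hi => hr hi

lemma IsMarkedPoissonProcess.tsum_measure_mem (h : IsMarkedPoissonProcess P lam z ρ)
    {A : Set (Rd d)} (hA : MeasurableSet A) (hb : Bornology.IsBounded A) :
    ∑' i, P {ω | z i ω ∈ A} = ENNReal.ofReal (lam * (volume : Measure (Rd d)).real A) := by
  have hS : ∀ i, MeasurableSet {ω | z i ω ∈ A} := fun i => h.measurable_point i hA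
  rw [← lintegral_encard_setOf P hS]
  have h1 := lintegral_poissonMeasure_descFactorial
    (lam * (volume : Measure (Rd d)).real A).toNNReal 1
  rw [← (h.poisson_count A hA hb).lintegral_comp (by fun_prop), pow_one] at h1
  refine Eq.trans (lintegral_congr_ae ?_) h1
  filter_upwards [h.ae_finite] with ω hω
  have hf := hω A hb
  simp only [Nat.descFactorial_one]
  rw [← hf.cast_ncard_eq]
  simp

/-- The second factorial moment of a Poisson number of points: the expected number of ordered pairs
of distinct points in `A` is the square of the expected number of points in `A`. -/
lemma IsMarkedPoissonProcess.tsum_measure_pair_mem (h : IsMarkedPoissonProcess P lam z ρ)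
    {A : Set (Rd d)} (hA : MeasurableSet A) (hb : Bornology.IsBounded A) :
    ∑' q : ℕ × ℕ, P {ω | q.1 ≠ q.2 ∧ z q.1 ω ∈ A ∧ z q.2 ω ∈ A} =
      ENNReal.ofReal (lam * (volume : Measure (Rd d)).real A) ^ 2 := by
  have hS : ∀ q : ℕ × ℕ, MeasurableSet {ω | q.1 ≠ q.2 ∧ z q.1 ω ∈ A ∧ z q.2 ω ∈ A} := fun q =>
    (MeasurableSet.const _).inter ((h.measurable_point q.1 hA).inter (h.measurable_point q.2 hA))
  rw [← lintegral_encard_setOf P hS]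
  have h1 := lintegral_poissonMeasure_descFactorial
    (lam * (volume : Measure (Rd d)).real A).toNNReal 2
  rw [← (h.poisson_count A hA hb).lintegral_comp (by fun_prop)] at h1
  refine Eq.trans (lintegral_congr_ae ?_) h1
  filter_upwards [h.ae_finite] with ω hω
  have hf := encard_offDiag_of_finite (hω A hb)
  have hs : {q : ℕ × ℕ | q.1 ≠ q.2 ∧ z q.1 ω ∈ A ∧ z q.2 ω ∈ A} =
      {i | z i ω ∈ A}.offDiag := by
    ext q
    simp [Set.mem_offDiag]
    tauto
  exact (congrArg (fun s : Set (ℕ × ℕ) => (s.encard : ℝ≥0∞)) hs).trans (by rw [hf]; simp)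

lemma IsMarkedPoissonProcess.lintegral_sq_sub (h : IsMarkedPoissonProcess P lam z ρ)
    (hlam : 0 ≤ lam) {A : Set (Rd d)} (hA : MeasurableSet A) (hb : Bornology.IsBounded A) :
    ∫⁻ ω, ENNReal.ofReal
      ((({i | z i ω ∈ A}.ncard : ℝ) - lam * (volume : Measure (Rd d)).real A) ^ 2) ∂P =
      ENNReal.ofReal (lam * (volume : Measure (Rd d)).real A) := by
  have h1 := lintegral_poissonMeasure_sq_sub (lam * (volume : Measure (Rd d)).real A).toNNReal
  rw [← (h.poisson_count A hA hb).lintegral_comp (by fun_prop),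
    Real.coe_toNNReal _ (by positivity)] at h1
  exact h1

end Counts

/-! ### A covering by overlapping cubes -/

/-- The cube of side `2 * r` whose lowest corner is the point `r • k` of the lattice `r ℤ^d`.
Neighbouring cubes overlap by half of their side. -/
def latticeCube {d : ℕ} (r : ℝ) (k : Fin d → ℤ) : Set (Rd d) :=
  {x | ∀ a, x a ∈ Ico (r * k a) (r * k a + 2 * r)}

lemma latticeCube_eq_preimage {d : ℕ} (r : ℝ) (k : Fin d → ℤ) :
    latticeCube r k = (@WithLp.ofLp 2 (Fin d → ℝ)) ⁻¹'
      (Set.univ.pi fun a => Ico (r * k a) (r * k a + 2 * r)) := by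
  ext x
  simp [latticeCube]

lemma measurableSet_latticeCube {d : ℕ} (r : ℝ) (k : Fin d → ℤ) :
    MeasurableSet (latticeCube r k) := by
  rw [latticeCube_eq_preimage]
  exact (PiLp.volume_preserving_ofLp (Fin d)).measurable
    (MeasurableSet.univ_pi fun _ => measurableSet_Ico)

lemma volume_real_latticeCube {d : ℕ} {r : ℝ} (hr : 0 ≤ r) (k : Fin d → ℤ) :
    (volume : Measure (Rd d)).real (latticeCube r k) = (2 * r) ^ d := by
  rw [latticeCube_eq_preimage, measureReal_def,
    (PiLp.volume_preserving_ofLp (Fin d)).measure_preimage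
      (MeasurableSet.univ_pi fun _ => measurableSet_Ico).nullMeasurableSet,
    Real.volume_pi_Ico_toReal fun a => by linarith]
  simp

lemma isBounded_latticeCube {d : ℕ} (r : ℝ) (k : Fin d → ℤ) :
    Bornology.IsBounded (latticeCube r k) := by
  rw [latticeCube_eq_preimage]
  exact (PiLp.antilipschitzWith_ofLp 2 (fun _ : Fin d => ℝ)).isBounded_preimage
    (Bornology.IsBounded.pi fun a => Metric.isBounded_Ico _ _)

/-- Two points of the ball of radius `T` at distance less than `r` lie in a common cube of a finite
family. -/
lemma exists_mem_latticeCube {d : ℕ} {r T : ℝ} (hr : 0 < r) {x y : Rd d}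
    (hx : x ∈ Metric.ball (0 : Rd d) T) (hy : y ∈ Metric.ball (0 : Rd d) T) (hxy : dist x y < r) :
    ∃ k ∈ Fintype.piFinset fun _ : Fin d => Finset.Icc (-⌈T / r⌉) ⌈T / r⌉,
      x ∈ latticeCube r k ∧ y ∈ latticeCube r k := by
  rw [mem_ball_zero_iff] at hx hy
  have hx' : ∀ a, |x a| < T := fun a => (PiLp.norm_apply_le x a).trans_lt hx
  have hy' : ∀ a, |y a| < T := fun a => (PiLp.norm_apply_le y a).trans_lt hy
  have hd : ∀ a, |x a - y a| < r := fun a => by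
    rw [dist_eq_norm] at hxy
    exact (PiLp.norm_apply_le (x - y) a).trans_lt hxy
  refine ⟨fun a => ⌊min (x a) (y a) / r⌋, ?_, ?_⟩
  · rw [Fintype.mem_piFinset]
    intro a
    have h1 : -T < min (x a) (y a) := lt_min (abs_lt.1 (hx' a)).1 (abs_lt.1 (hy' a)).1
    have h2 : min (x a) (y a) < T := (min_le_left _ _).trans_lt (abs_lt.1 (hx' a)).2
    rw [Finset.mem_Icc]
    constructor
    · rw [Int.le_floor]
      push_cast
      have h3 := Int.le_ceil (T / r)
      have h4 : -(T / r) ≤ min (x a) (y a) / r := by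
        rw [← neg_div]
        gcongr
      linarith
    · have h3 : min (x a) (y a) / r ≤ T / r := by gcongr
      exact (Int.cast_le (R := ℝ)).1 ((Int.floor_le _).trans (h3.trans (Int.le_ceil _)))
  · have h1 : ∀ a, r * (⌊min (x a) (y a) / r⌋ : ℝ) ≤ min (x a) (y a) := fun a => by
      have := Int.floor_le (min (x a) (y a) / r)
      rw [le_div_iff₀ hr] at this
      linarith
    have h2 : ∀ a, min (x a) (y a) < r * (⌊min (x a) (y a) / r⌋ : ℝ) + r := fun a => by
      have := Int.lt_floor_add_one (min (x a) (y a) / r)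
      rw [div_lt_iff₀ hr] at this
      linarith
    have h3 : ∀ a, max (x a) (y a) < min (x a) (y a) + r := fun a => by
      have := hd a
      rw [← max_sub_min_eq_abs] at this
      have e : max (y a) (x a) = max (x a) (y a) := max_comm _ _
      have e' : min (y a) (x a) = min (x a) (y a) := min_comm _ _
      linarith
    constructor
    · intro a
      exact ⟨(h1 a).trans (min_le_left _ _),
        by linarith [le_max_left (x a) (y a), h2 a, h3 a]⟩
    · intro a
      exact ⟨(h1 a).trans (min_le_right _ _),
        by linarith [le_max_right (x a) (y a), h2 a, h3 a]⟩

lemma card_piFinset_Icc_ceil_le {d : ℕ} {r T : ℝ} (hr : 0 < r) (hT : 0 < T) :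
    ((Fintype.piFinset fun _ : Fin d => Finset.Icc (-⌈T / r⌉) ⌈T / r⌉).card : ℝ) ≤
      (3 * (T + r) / r) ^ d := by
  rw [Fintype.card_piFinset]
  simp only [Int.card_Icc, Finset.prod_const, Finset.card_univ, Fintype.card_fin, Nat.cast_pow]
  gcongr
  have h0 : 0 ≤ ⌈T / r⌉ := Int.ceil_nonneg (by positivity)
  have h1 : (((⌈T / r⌉ + 1 - -⌈T / r⌉).toNat : ℤ) : ℝ) = 2 * (⌈T / r⌉ : ℝ) + 1 := by
    rw [Int.toNat_of_nonneg (by omega)]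
    push_cast
    ring
  have h2 := (Int.ceil_lt_add_one (T / r)).le
  have h3 : 3 * (T + r) / r = 3 * (T / r) + 3 := by field_simp
  have h4 : 0 ≤ T / r := by positivity
  rw [h3]
  rw [Int.cast_natCast] at h1
  rw [h1]
  linarith

/-! ### Pairs of close points -/

/-- The ordered pairs `(i, j)` of distinct points in `A` whose distance is less than a threshold
`g (ρ j)` that depends on the radius of the second point. -/
def closePairs {d : ℕ} (z : ℕ → Rd d) (ρ : ℕ → ℝ) (A : Set (Rd d)) (g : ℝ → ℝ) : Set (ℕ × ℕ) :=
  {q | q.1 ≠ q.2 ∧ z q.1 ∈ A ∧ z q.2 ∈ A ∧ dist (z q.1) (z q.2) < g (ρ q.2)}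

section Pairs

variable {d : ℕ} {Ω : Type*} [MeasurableSpace Ω] {P : Measure Ω} {lam : ℝ}
  {z : ℕ → Ω → Rd d} {ρ : ℕ → Ω → ℝ}

lemma IsMarkedPoissonProcess.tsum_measure_dist_lt_le (h : IsMarkedPoissonProcess P lam z ρ)
    (hlam : 0 ≤ lam) {r T : ℝ} (hr : 0 < r) (hT : 0 < T) :
    ∑' q : ℕ × ℕ, P {ω | q.1 ≠ q.2 ∧ z q.1 ω ∈ Metric.ball (0 : Rd d) T ∧
        z q.2 ω ∈ Metric.ball (0 : Rd d) T ∧ dist (z q.1 ω) (z q.2 ω) < r} ≤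
      ENNReal.ofReal (lam ^ 2 * 12 ^ d * (T + r) ^ d * r ^ d) := by
  set K := Fintype.piFinset fun _ : Fin d => Finset.Icc (-⌈T / r⌉) ⌈T / r⌉
  calc _ ≤ ∑' q : ℕ × ℕ, ∑ k ∈ K,
        P {ω | q.1 ≠ q.2 ∧ z q.1 ω ∈ latticeCube r k ∧ z q.2 ω ∈ latticeCube r k} := by
        refine ENNReal.tsum_le_tsum fun q => le_trans (measure_mono ?_)
          (measure_biUnion_finset_le K _)
        rintro ω ⟨hq, h1, h2, h3⟩
        obtain ⟨k, hk, hk1, hk2⟩ := exists_mem_latticeCube hr h1 h2 h3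
        exact mem_biUnion hk ⟨hq, hk1, hk2⟩
    _ = ∑ k ∈ K, ∑' q : ℕ × ℕ,
        P {ω | q.1 ≠ q.2 ∧ z q.1 ω ∈ latticeCube r k ∧ z q.2 ω ∈ latticeCube r k} :=
        Summable.tsum_finsetSum fun _ _ => ENNReal.summable
    _ = ∑ k ∈ K, ENNReal.ofReal ((lam * (2 * r) ^ d) ^ 2) := by
        refine Finset.sum_congr rfl fun k _ => ?_
        rw [h.tsum_measure_pair_mem (measurableSet_latticeCube r k) (isBounded_latticeCube r k),
          volume_real_latticeCube hr.le, ENNReal.ofReal_pow (by positivity)]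
    _ = ENNReal.ofReal (K.card * (lam * (2 * r) ^ d) ^ 2) := by
        rw [Finset.sum_const, nsmul_eq_mul, ENNReal.ofReal_mul (by positivity),
          ENNReal.ofReal_natCast]
    _ ≤ _ := by
        refine ENNReal.ofReal_le_ofReal ?_
        refine (mul_le_mul_of_nonneg_right (card_piFinset_Icc_ceil_le hr hT)
          (by positivity)).trans (le_of_eq ?_)
        have : (12 : ℝ) ^ d = 3 ^ d * (2 ^ d) ^ 2 := by
          rw [← pow_mul, mul_comm d 2, pow_mul, ← mul_pow]
          norm_num
        rw [this, div_pow, mul_pow, mul_pow, mul_pow]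
        field_simp

lemma measurableSet_mem_closePairs (h : IsMarkedPoissonProcess P lam z ρ) {A : Set (Rd d)}
    (hA : MeasurableSet A) {g : ℝ → ℝ} (hg : Measurable g) (q : ℕ × ℕ) :
    MeasurableSet {ω | q ∈ closePairs (z · ω) (ρ · ω) A g} :=
  (MeasurableSet.const _).inter ((h.measurable_point q.1 hA).inter
    ((h.measurable_point q.2 hA).inter (measurableSet_lt
      ((h.measurable_point q.1).dist (h.measurable_point q.2))
      (hg.comp (h.measurable_radius q.2)))))

/-- As the radii are independent of the points, the expected number of close pairs is obtained by
freezing the radius first. -/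
lemma IsMarkedPoissonProcess.lintegral_encard_closePairs_le [IsProbabilityMeasure P]
    (h : IsMarkedPoissonProcess P lam z ρ) (hlam : 0 ≤ lam) {T : ℝ} (hT : 0 < T) {g : ℝ → ℝ}
    (hg : Measurable g) (hg0 : ∀ s, 0 < g s) :
    ∫⁻ ω, ((closePairs (z · ω) (ρ · ω) (Metric.ball 0 T) g).encard : ℝ≥0∞) ∂P ≤
      ∫⁻ ω, ENNReal.ofReal (lam ^ 2 * 12 ^ d * (T + g (ρ 0 ω)) ^ d * g (ρ 0 ω) ^ d) ∂P := by
  have hm := measurableSet_mem_closePairs h (measurableSet_ball (x := 0) (ε := T)) hg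
  refine (lintegral_encard_setOf P hm).trans_le ?_
  -- the event that `q` is a close pair, as a set of positions and radii
  let E : ℕ × ℕ → Set ((Rd d × Rd d) × ℝ) := fun q =>
    {w | q.1 ≠ q.2 ∧ w.1.1 ∈ Metric.ball 0 T ∧ w.1.2 ∈ Metric.ball 0 T ∧
      dist w.1.1 w.1.2 < g w.2}
  have hE : ∀ q, MeasurableSet (E q) := fun q =>
    (MeasurableSet.const _).inter (((measurable_fst.comp measurable_fst) measurableSet_ball).inter
      (((measurable_snd.comp measurable_fst) measurableSet_ball).inter (measurableSet_lt
        ((measurable_fst.comp measurable_fst).dist (measurable_snd.comp measurable_fst))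
        (hg.comp measurable_snd))))
  have hz : ∀ q : ℕ × ℕ, Measurable fun ω => (z q.1 ω, z q.2 ω) := fun q =>
    (h.measurable_point q.1).prodMk (h.measurable_point q.2)
  have key : ∀ q : ℕ × ℕ, P {ω | q ∈ closePairs (z · ω) (ρ · ω) (Metric.ball 0 T) g} =
      ∫⁻ s, P {ω | ((z q.1 ω, z q.2 ω), s) ∈ E q} ∂(P.map (ρ 0)) := by
    intro q
    have hi : IndepFun (fun ω => (z q.1 ω, z q.2 ω)) (ρ q.2) P :=
      h.indep_point_radius.comp
        (φ := fun w : ℕ → Rd d => (w q.1, w q.2)) (ψ := fun w : ℕ → ℝ => w q.2)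
        (by fun_prop) (by fun_prop)
    have hl := (indepFun_iff_map_prod_eq_prod_map_map (hz q).aemeasurable
      (h.measurable_radius q.2).aemeasurable).1 hi
    have h1 : P {ω | q ∈ closePairs (z · ω) (ρ · ω) (Metric.ball 0 T) g} =
        P.map (fun ω => ((z q.1 ω, z q.2 ω), ρ q.2 ω)) (E q) := by
      rw [Measure.map_apply ((hz q).prodMk (h.measurable_radius q.2)) (hE q)]
      rfl
    rw [h1, hl, (h.identDistrib_radius q.2).map_eq, Measure.prod_apply_symm (hE q)]
    refine lintegral_congr fun s => ?_
    rw [Measure.map_apply (hz q) (measurable_prodMk_right (hE q))]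
    rfl
  have hmeas : ∀ q, Measurable fun s => P {ω | ((z q.1 ω, z q.2 ω), s) ∈ E q} := by
    intro q
    have := measurable_measure_prodMk_right (μ := P.map fun ω => (z q.1 ω, z q.2 ω)) (hE q)
    convert this using 2 with s
    rw [Measure.map_apply (hz q) (measurable_prodMk_right (hE q))]
    rfl
  simp_rw [key]
  rw [← lintegral_tsum fun q => (hmeas q).aemeasurable,
    ← lintegral_map (μ := P) (g := ρ 0)
      (f := fun s => ENNReal.ofReal (lam ^ 2 * 12 ^ d * (T + g s) ^ d * g s ^ d))
      (by fun_prop) (h.measurable_radius 0)]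
  refine lintegral_mono fun s => ?_
  exact h.tsum_measure_dist_lt_le hlam (hg0 s) hT

end Pairs

/-! ### Almost sure convergence from first moments -/

lemma ae_tendsto_zero_of_tsum_lintegral_ne_top {Ω : Type*} [MeasurableSpace Ω] {P : Measure Ω}
    {Y : ℕ → Ω → ℝ≥0∞} (hY : ∀ k, AEMeasurable (Y k) P) (hs : ∑' k, ∫⁻ ω, Y k ω ∂P ≠ ∞) :
    ∀ᵐ ω ∂P, Tendsto (fun k => Y k ω) atTop (𝓝 0) := by
  rw [← lintegral_tsum hY] at hs
  filter_upwards [ae_lt_top' (AEMeasurable.tsum hY) hs] with ω hω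
  exact ENNReal.tendsto_atTop_zero_of_tsum_ne_top hω.ne

lemma tendsto_zero_of_le_dyadic {F : ℝ → ℝ≥0∞} {Y : ℕ → ℝ≥0∞} (hY : Tendsto Y atTop (𝓝 0))
    (h : ∀ (k : ℕ) (ε : ℝ), (1 / 2) ^ (k + 1) < ε → ε ≤ (1 / 2) ^ k → F ε ≤ Y k) :
    Tendsto F (𝓝[>] 0) (𝓝 0) := by
  rw [ENNReal.tendsto_nhds_zero] at hY ⊢
  intro e he
  obtain ⟨N, hN⟩ := eventually_atTop.1 (hY e he)
  have h2 : Ioo (0 : ℝ) ((1 / 2) ^ N) ∈ 𝓝[>] (0 : ℝ) := Ioo_mem_nhdsGT (by positivity)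
  filter_upwards [h2] with ε hε
  obtain ⟨k, hk1, hk2⟩ := exists_nat_pow_near_of_lt_one (x := ε) (y := 1 / 2) hε.1
    (hε.2.le.trans (pow_le_one₀ (by norm_num) (by norm_num))) (by norm_num) (by norm_num)
  have hkN : N < k + 1 :=
    (pow_lt_pow_iff_right_of_lt_one₀ (by norm_num) (by norm_num)).1 (hk1.trans hε.2)
  exact (h k ε hk1 hk2).trans (hN k (by omega))

/-- If the majorants `Y k` of `F` on the dyadic intervals have geometrically decaying expectations,
then `F` tends to zero almost surely. -/
lemma ae_tendsto_zero_of_dyadic_majorant {Ω : Type*} [MeasurableSpace Ω] {P : Measure Ω}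
    {F : Ω → ℝ → ℝ≥0∞} {Y : ℕ → Ω → ℝ≥0∞} (hY : ∀ k, AEMeasurable (Y k) P) {q : ℝ}
    (hq0 : 0 ≤ q) (hq : q < 1) {M : ℝ≥0∞} (hM : M ≠ ∞)
    (hi : ∀ k, ∫⁻ ω, Y k ω ∂P ≤ ENNReal.ofReal (q ^ k) * M)
    (h : ∀ᵐ ω ∂P, ∀ (k : ℕ) (ε : ℝ), (1 / 2) ^ (k + 1) < ε → ε ≤ (1 / 2) ^ k → F ω ε ≤ Y k ω) :
    ∀ᵐ ω ∂P, Tendsto (F ω) (𝓝[>] 0) (𝓝 0) := by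
  have hs : ∑' k, ∫⁻ ω, Y k ω ∂P ≠ ∞ := by
    refine ne_top_of_le_ne_top ?_ (ENNReal.tsum_le_tsum hi)
    rw [ENNReal.tsum_mul_right, ← ENNReal.ofReal_tsum_of_nonneg (fun k => by positivity)
      (summable_geometric_of_lt_one hq0 hq)]
    exact ENNReal.mul_ne_top ENNReal.ofReal_ne_top hM
  filter_upwards [ae_tendsto_zero_of_tsum_lintegral_ne_top hY hs, h] with ω h1 h2
  exact tendsto_zero_of_le_dyadic h1 h2

/-! ### The sum of powers of the radii -/

lemma inv_smul_subset_ball {d : ℕ} {D : Set (Rd d)} {L ε T : ℝ} (hε : 0 < ε)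
    (hD : D ⊆ Metric.ball 0 L) (hT : ε⁻¹ * L ≤ T) : ε⁻¹ • D ⊆ Metric.ball 0 T := by
  rintro _ ⟨x, hx, rfl⟩
  have := hD hx
  rw [mem_ball_zero_iff] at this ⊢
  simp only [norm_smul, norm_inv, Real.norm_eq_abs, abs_of_pos hε]
  have h2 : ε⁻¹ * ‖x‖ < ε⁻¹ * L := by gcongr
  linarith

lemma inv_le_of_dyadic {k : ℕ} {ε : ℝ} (h : (1 / 2) ^ (k + 1) < ε) : ε⁻¹ ≤ 2 * 2 ^ k := by
  have h1 : ε⁻¹ ≤ ((1 / 2 : ℝ) ^ (k + 1))⁻¹ := inv_anti₀ (by positivity) h.le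
  rw [← inv_pow, one_div, inv_inv, pow_succ] at h1
  linarith

section AlmostSure

variable {d : ℕ} {Ω : Type*} [MeasurableSpace Ω] {P : Measure Ω} {lam : ℝ}
  {z : ℕ → Ω → Rd d} {ρ : ℕ → Ω → ℝ}

lemma volume_real_ball_zero {r : ℝ} (hr : 0 < r) :
    (volume : Measure (Rd d)).real (Metric.ball 0 r) =
      r ^ d * (volume : Measure (Rd d)).real (Metric.ball 0 1) := by
  rw [measureReal_def, Measure.addHaar_ball_of_pos _ _ hr, ENNReal.toReal_mul,
    ENNReal.toReal_ofReal (by positivity), finrank_euclideanSpace_fin, measureReal_def]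

lemma IsMarkedPoissonProcess.lintegral_tsum_radius [IsProbabilityMeasure P]
    (h : IsMarkedPoissonProcess P lam z ρ) {A : Set (Rd d)} (hA : MeasurableSet A)
    (hb : Bornology.IsBounded A) {f : ℝ → ℝ≥0∞} (hf : Measurable f) :
    ∫⁻ ω, ∑' i, {i | z i ω ∈ A}.indicator (fun i => f (ρ i ω)) i ∂P =
      ENNReal.ofReal (lam * (volume : Measure (Rd d)).real A) * ∫⁻ ω, f (ρ 0 ω) ∂P := by
  have e : ∀ i ω, {i | z i ω ∈ A}.indicator (fun i => f (ρ i ω)) i =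
      {ω | z i ω ∈ A}.indicator (fun _ => (1 : ℝ≥0∞)) ω * f (ρ i ω) := by
    intro i ω
    by_cases hi : z i ω ∈ A <;> simp [Set.indicator, hi]
  have hS : ∀ i, MeasurableSet {ω | z i ω ∈ A} := fun i => h.measurable_point i hA
  have hm1 : ∀ i, Measurable ({ω | z i ω ∈ A}.indicator fun _ => (1 : ℝ≥0∞)) := fun i =>
    measurable_const.indicator (hS i)
  have hm2 : ∀ i, Measurable fun ω => f (ρ i ω) := fun i => hf.comp (h.measurable_radius i)
  simp_rw [e]
  rw [lintegral_tsum (f := fun i ω => {ω | z i ω ∈ A}.indicator (fun _ => (1 : ℝ≥0∞)) ω * f (ρ i ω))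
    fun i => ((hm1 i).mul (hm2 i)).aemeasurable, ← h.tsum_measure_mem hA hb,
    ← ENNReal.tsum_mul_right]
  refine tsum_congr fun i => ?_
  have hi : IndepFun ({ω | z i ω ∈ A}.indicator fun _ => (1 : ℝ≥0∞)) (fun ω => f (ρ i ω)) P :=
    h.indep_point_radius.comp (φ := fun w : ℕ → Rd d => A.indicator (fun _ => (1 : ℝ≥0∞)) (w i))
      (ψ := fun w : ℕ → ℝ => f (w i))
      ((measurable_const.indicator hA).comp (measurable_pi_apply i))
      (hf.comp (measurable_pi_apply i))
  have hl := lintegral_mul_eq_lintegral_mul_lintegral_of_indepFun (hm1 i) (hm2 i) hi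
  simp only [Pi.mul_apply] at hl
  rw [hl, lintegral_indicator (hS i), lintegral_one, Measure.restrict_apply_univ]
  congr 1
  exact ((h.identDistrib_radius i).comp hf).lintegral_eq

/-- The sum of the `p`-th powers of the radii grows at most like `ε ^ (-d)`, up to an arbitrarily
small power of `ε`. -/
lemma IsMarkedPoissonProcess.ae_tendsto_tsum_radius [IsProbabilityMeasure P]
    (h : IsMarkedPoissonProcess P lam z ρ) (hlam : 0 ≤ lam) {D : Set (Rd d)}
    (hb : Bornology.IsBounded D) {p κ : ℝ} (hκ : 0 < κ)
    (hp : ∫⁻ ω, ENNReal.ofReal (ρ 0 ω ^ p) ∂P ≠ ∞) :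
    ∀ᵐ ω ∂P, Tendsto (fun ε : ℝ => ∑' i, (pointsIn (z · ω) D ε).indicator
      (fun i => ENNReal.ofReal (ε ^ ((d : ℝ) + κ)) * ENNReal.ofReal (ρ i ω ^ p)) i)
      (𝓝[>] 0) (𝓝 0) := by
  obtain ⟨L, hL0, hL⟩ := hb.subset_ball_lt 0 (0 : Rd d)
  set c : ℕ → ℝ := fun k => ((1 / 2 : ℝ) ^ k) ^ ((d : ℝ) + κ)
  set f : ℕ → ℝ → ℝ≥0∞ := fun k s => ENNReal.ofReal (c k) * ENNReal.ofReal (s ^ p)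
  have hf : ∀ k, Measurable (f k) := fun k => by fun_prop
  refine ae_tendsto_zero_of_dyadic_majorant
    (Y := fun k ω => ∑' i, {i | z i ω ∈ Metric.ball (0 : Rd d) (2 * 2 ^ k * L)}.indicator
      (fun i => f k (ρ i ω)) i)
    (q := (1 / 2 : ℝ) ^ κ)
    (M := ENNReal.ofReal (lam * (2 * L) ^ d * (volume : Measure (Rd d)).real (Metric.ball 0 1)) *
      ∫⁻ ω, ENNReal.ofReal (ρ 0 ω ^ p) ∂P)
    ?_ (by positivity) (Real.rpow_lt_one (by norm_num) (by norm_num) hκ)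
    (ENNReal.mul_ne_top ENNReal.ofReal_ne_top hp) ?_ ?_
  · intro k
    refine AEMeasurable.tsum fun i => Measurable.aemeasurable ?_
    exact ((hf k).comp (h.measurable_radius i)).indicator
      (h.measurable_point i (measurableSet_ball (x := 0) (ε := 2 * 2 ^ k * L)))
  · intro k
    rw [h.lintegral_tsum_radius measurableSet_ball Metric.isBounded_ball (hf k),
      lintegral_const_mul' _ _ ENNReal.ofReal_ne_top, ← mul_assoc, ← mul_assoc,
      ← ENNReal.ofReal_mul (by positivity), ← ENNReal.ofReal_mul (by positivity)]
    refine le_of_eq ?_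
    congr 2
    rw [volume_real_ball_zero (by positivity)]
    have e1 : c k = ((1 / 2 : ℝ) ^ k) ^ d * ((1 / 2 : ℝ) ^ κ) ^ k := by
      simp only [c]
      rw [Real.rpow_add (by positivity), Real.rpow_natCast, ← Real.rpow_natCast (1 / 2) k,
        ← Real.rpow_mul (by norm_num), mul_comm (k : ℝ) κ, Real.rpow_mul (by norm_num),
        Real.rpow_natCast, Real.rpow_natCast]
    have e2 : ((1 / 2 : ℝ) ^ k) ^ d * (2 * 2 ^ k * L) ^ d = (2 * L) ^ d := by
      rw [← mul_pow]
      congr 1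
      rw [one_div, inv_pow]
      field_simp
    rw [e1, ← e2]
    ring
  · refine ae_of_all _ fun ω k ε h1 h2 => ENNReal.tsum_le_tsum fun i => ?_
    have hε : 0 < ε := lt_trans (by positivity) h1
    refine (indicator_le_indicator_of_subset (fun i hi => ?_) (fun _ => zero_le) i).trans
      (indicator_le_indicator ?_)
    · exact inv_smul_subset_ball hε hL
        (mul_le_mul_of_nonneg_right (inv_le_of_dyadic h1) hL0.le) hi
    · simp only [f, c]
      gcongr

/-! ### The law of large numbers for the number of points -/

lemma StarConvex.smul_subset_smul_of_le {E : Type*} [AddCommGroup E] [Module ℝ E] {D : Set E}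
    (hD : StarConvex ℝ 0 D) {s t : ℝ} (hs : 0 ≤ s) (ht : 0 < t) (hst : s ≤ t) :
    s • D ⊆ t • D := by
  rintro _ ⟨x, hx, rfl⟩
  refine ⟨(s / t) • x, hD.smul_mem hx (by positivity) (by rwa [div_le_one ht]), ?_⟩
  simp only [smul_smul]
  rw [mul_div_cancel₀ _ ht.ne']

/-- Along the integers, Chebyshev's inequality and the Borel–Cantelli lemma apply, since the
variance of the number of points in `m • D` is of order `m ^ d` and `d ≥ 2`. -/
lemma IsMarkedPoissonProcess.ae_tendsto_ncard_nat (h : IsMarkedPoissonProcess P lam z ρ)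
    (hlam : 0 ≤ lam) (hd : 1 < d) {D : Set (Rd d)} (hm : MeasurableSet D)
    (hb : Bornology.IsBounded D) :
    ∀ᵐ ω ∂P, Tendsto (fun m : ℕ => ({i | z i ω ∈ (m : ℝ) • D}.ncard : ℝ) / (m : ℝ) ^ d) atTop
      (𝓝 (lam * (volume : Measure (Rd d)).real D)) := by
  set c := lam * (volume : Measure (Rd d)).real D
  have hvol : ∀ m : ℕ, lam * (volume : Measure (Rd d)).real (((m + 1 : ℕ) : ℝ) • D) =
      ((m + 1 : ℕ) : ℝ) ^ d * c := by
    intro m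
    rw [measureReal_def, Measure.addHaar_smul, ENNReal.toReal_mul,
      ENNReal.toReal_ofReal (abs_nonneg _), finrank_euclideanSpace_fin, abs_of_nonneg (by positivity),
      ← measureReal_def]
    simp only [c]
    ring
  have hmeas : ∀ m : ℕ, MeasurableSet (((m + 1 : ℕ) : ℝ) • D) := fun m =>
    hm.const_smul₀ _
  have hbdd : ∀ m : ℕ, Bornology.IsBounded (((m + 1 : ℕ) : ℝ) • D) := fun m => hb.smul₀ _
  have key : ∀ᵐ ω ∂P, Tendsto (fun m : ℕ => ENNReal.ofReal
      ((({i | z i ω ∈ ((m + 1 : ℕ) : ℝ) • D}.ncard : ℝ) / ((m + 1 : ℕ) : ℝ) ^ d - c) ^ 2))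
      atTop (𝓝 0) := by
    have e : ∀ (m : ℕ) (ω : Ω), ENNReal.ofReal
        ((({i | z i ω ∈ ((m + 1 : ℕ) : ℝ) • D}.ncard : ℝ) / ((m + 1 : ℕ) : ℝ) ^ d - c) ^ 2) =
        ENNReal.ofReal (((((m + 1 : ℕ) : ℝ) ^ d) ^ 2)⁻¹) * ENNReal.ofReal
        ((({i | z i ω ∈ ((m + 1 : ℕ) : ℝ) • D}.ncard : ℝ) -
          lam * (volume : Measure (Rd d)).real (((m + 1 : ℕ) : ℝ) • D)) ^ 2) := by
      intro m ω
      rw [← ENNReal.ofReal_mul (by positivity), hvol]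
      congr 1
      have : (((m + 1 : ℕ) : ℝ) ^ d) ≠ 0 := by positivity
      field_simp
    simp_rw [e]
    refine ae_tendsto_zero_of_tsum_lintegral_ne_top (fun m => ?_) ?_
    · have := (h.poisson_count _ (hmeas m) (hbdd m)).aemeasurable
      have h2 : AEMeasurable
          (fun ω => ({i | z i ω ∈ ((m + 1 : ℕ) : ℝ) • D}.ncard : ℝ)) P :=
        (Measurable.of_discrete (f := fun n : ℕ => (n : ℝ))).comp_aemeasurable this
      fun_prop
    · have e2 : ∀ m : ℕ, ∫⁻ ω, ENNReal.ofReal (((((m + 1 : ℕ) : ℝ) ^ d) ^ 2)⁻¹) * ENNReal.ofReal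
          ((({i | z i ω ∈ ((m + 1 : ℕ) : ℝ) • D}.ncard : ℝ) -
            lam * (volume : Measure (Rd d)).real (((m + 1 : ℕ) : ℝ) • D)) ^ 2) ∂P =
          ENNReal.ofReal ((((m + 1 : ℕ) : ℝ) ^ d)⁻¹ * c) := by
        intro m
        rw [lintegral_const_mul' _ _ ENNReal.ofReal_ne_top,
          h.lintegral_sq_sub hlam (hmeas m) (hbdd m), ← ENNReal.ofReal_mul (by positivity), hvol]
        congr 1
        have : (((m + 1 : ℕ) : ℝ) ^ d) ≠ 0 := by positivity
        field_simp
      simp_rw [e2]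
      have hsum : Summable fun m : ℕ => (((m + 1 : ℕ) : ℝ) ^ d)⁻¹ * c :=
        ((summable_nat_add_iff 1).2 (Real.summable_nat_pow_inv.2 hd)).mul_right c
      rw [← ENNReal.ofReal_tsum_of_nonneg (fun m => by positivity) hsum]
      exact ENNReal.ofReal_ne_top
  filter_upwards [key] with ω hω
  rw [← tendsto_add_atTop_iff_nat 1]
  have h1 := (ENNReal.tendsto_toReal ENNReal.zero_ne_top).comp hω
  have h2 := (Real.continuous_sqrt.tendsto _).comp h1
  simp only [Function.comp_def, ENNReal.toReal_zero, Real.sqrt_zero,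
    ENNReal.toReal_ofReal (sq_nonneg _), Real.sqrt_sq_eq_abs] at h2
  exact tendsto_sub_nhds_zero_iff.1 ((tendsto_zero_iff_abs_tendsto_zero _).2 h2)

lemma IsMarkedPoissonProcess.ae_tendsto_ncard_pointsIn (h : IsMarkedPoissonProcess P lam z ρ)
    (hlam : 0 ≤ lam) (hd : 1 < d) {D : Set (Rd d)} (hm : MeasurableSet D)
    (hb : Bornology.IsBounded D) (hstar : StarConvex ℝ 0 D) :
    ∀ᵐ ω ∂P, Tendsto (fun ε : ℝ => ε ^ d * ((pointsIn (z · ω) D ε).ncard : ℝ)) (𝓝[>] 0)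
      (𝓝 (lam * (volume : Measure (Rd d)).real D)) := by
  filter_upwards [h.ae_tendsto_ncard_nat hlam hd hm hb, h.ae_finite] with ω hω hfin
  set N : ℝ → ℝ := fun t => ({i | z i ω ∈ t • D}.ncard : ℝ)
  have hmono : ∀ s t : ℝ, 0 ≤ s → 0 < t → s ≤ t → N s ≤ N t := by
    intro s t hs ht hst
    refine Nat.cast_le.2 (Set.ncard_le_ncard ?_ (hfin _ (hb.smul₀ t)))
    exact fun i hi => hstar.smul_subset_smul_of_le hs ht hst hi
  have hfl := tendsto_nat_floor_atTop (α := ℝ)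
  have hfl1 : Tendsto (fun t : ℝ => ⌊t⌋₊ + 1) atTop atTop :=
    (tendsto_add_atTop_nat 1).comp hfl
  have hr := tendsto_nat_floor_div_atTop (R := ℝ)
  have hr1 : Tendsto (fun t : ℝ => ((⌊t⌋₊ + 1 : ℕ) : ℝ) / t) atTop (𝓝 1) := by
    have := hr.add tendsto_inv_atTop_zero
    rw [add_zero] at this
    refine this.congr fun t => ?_
    push_cast
    rw [add_div, one_div]
  have hmain : Tendsto (fun t : ℝ => N t / t ^ d) atTop
      (𝓝 (lam * (volume : Measure (Rd d)).real D)) := by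
    have hlo := (hr.pow d).mul (hω.comp hfl)
    have hup := (hr1.pow d).mul (hω.comp hfl1)
    rw [one_pow, one_mul] at hlo hup
    refine tendsto_of_tendsto_of_tendsto_of_le_of_le' hlo hup ?_ ?_
    · filter_upwards [eventually_ge_atTop 1] with t ht
      have h0 : (0 : ℝ) < ⌊t⌋₊ := Nat.cast_pos.2 (Nat.floor_pos.2 ht)
      have h1 := hmono ⌊t⌋₊ t h0.le (by linarith) (Nat.floor_le (by linarith))
      calc (⌊t⌋₊ / t : ℝ) ^ d * (N ⌊t⌋₊ / (⌊t⌋₊ : ℝ) ^ d) = N ⌊t⌋₊ / t ^ d := by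
            rw [div_pow]
            field_simp
        _ ≤ N t / t ^ d := by gcongr
    · filter_upwards [eventually_ge_atTop 1] with t ht
      have h0 : (0 : ℝ) < (⌊t⌋₊ + 1 : ℕ) := by positivity
      have h1 := hmono t (⌊t⌋₊ + 1 : ℕ) (by linarith) h0
        (by push_cast; exact (Nat.lt_floor_add_one t).le)
      calc N t / t ^ d ≤ N (⌊t⌋₊ + 1 : ℕ) / t ^ d := by gcongr
        _ = (((⌊t⌋₊ + 1 : ℕ) : ℝ) / t) ^ d *
            (N (⌊t⌋₊ + 1 : ℕ) / ((⌊t⌋₊ + 1 : ℕ) : ℝ) ^ d) := by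
            rw [div_pow]
            field_simp
  refine (hmain.comp tendsto_inv_nhdsGT_zero).congr fun ε => ?_
  simp only [Function.comp, N, pointsIn, inv_pow, div_inv_eq_mul]
  ring

/-! ### The number of close pairs -/

lemma min_pow_le_rpow {d : ℕ} {p x : ℝ} (hp : 0 < p) (hpd : p ≤ d) (hx : 0 ≤ x) :
    min x 2 ^ d ≤ 2 ^ d * x ^ p := by
  rcases le_total x 1 with h | h
  · have h1 : (1 : ℝ) ≤ 2 ^ d := one_le_pow₀ (by norm_num)
    have h3 : x ^ d ≤ x ^ p := by
      rcases hx.eq_or_lt with rfl | h0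
      · rw [Real.zero_rpow hp.ne', zero_pow]
        rintro rfl
        simp at hpd
        linarith
      · rw [← Real.rpow_natCast]
        exact Real.rpow_le_rpow_of_exponent_ge h0 h hpd
    have h4 : min x 2 ^ d ≤ x ^ d := by gcongr; exact min_le_left _ _
    nlinarith [Real.rpow_nonneg hx p]
  · have h1 : 1 ≤ x ^ p := Real.one_le_rpow h hp.le
    have h2 : min x 2 ^ d ≤ 2 ^ d := by gcongr; exact min_le_right _ _
    nlinarith [pow_pos (zero_lt_two (α := ℝ)) d]

/-- With the radius of the second point frozen at `s`, the left-hand side is, up to a constant, the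
bound on `e ^ d` times the expected number of close pairs at scale `e`; it gains a factor `e ^ κ`.
The truncation at `2 / e` is what allows a moment of order `p ≤ d` to suffice. -/
lemma closePairs_density_le {d : ℕ} {p a γ L e s κ : ℝ} (hp : 0 < p) (hpd : p ≤ d)
    (ha : 0 < a) (hκ1 : κ ≤ a * d) (hκ2 : κ ≤ p * (γ + 1) - d) (hL : 0 < L) (he : 0 < e)
    (he1 : e ≤ 1) (hs : 0 ≤ s) :
    e ^ d * ((2 / e * L + (3 * e ^ a + 4 * min (e ^ γ * s) (2 / e))) ^ d *
      (3 * e ^ a + 4 * min (e ^ γ * s) (2 / e)) ^ d) ≤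
    e ^ κ * ((2 * L + 11) ^ d * 2 ^ d * (3 ^ d + 8 ^ d * s ^ p)) := by
  set m := min (e ^ γ * s) (2 / e)
  have hm0 : 0 ≤ m := le_min (by positivity) (by positivity)
  have hea : e ^ a ≤ 1 := Real.rpow_le_one he.le he1 ha.le
  have hinv : 1 ≤ 1 / e := (one_le_div he).2 he1
  have h1 : (2 / e * L + (3 * e ^ a + 4 * m)) ^ d ≤ ((2 * L + 11) / e) ^ d := by
    have : m ≤ 2 * (1 / e) := (min_le_right _ _).trans (by rw [mul_one_div])
    have e2 : (2 * L + 11) / e = 2 / e * L + (3 * (1 / e) + 4 * (2 * (1 / e))) := by ring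
    rw [e2]
    gcongr
    linarith
  have hem : m = e⁻¹ * min (e ^ (γ + 1) * s) 2 := by
    rw [mul_min_of_nonneg _ _ (by positivity), Real.rpow_add he, Real.rpow_one]
    simp only [m]
    congr 1 <;> field_simp
  have h2 : m ^ d ≤ (e⁻¹) ^ d * (2 ^ d * (e ^ (p * (γ + 1)) * s ^ p)) := by
    rw [hem, mul_pow]
    gcongr
    refine (min_pow_le_rpow hp hpd (by positivity)).trans (le_of_eq ?_)
    rw [Real.mul_rpow (by positivity) hs, ← Real.rpow_mul he.le, mul_comm p]
  have h3 : (3 * e ^ a + 4 * m) ^ d ≤ 2 ^ d * ((3 * e ^ a) ^ d + (4 * m) ^ d) := by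
    refine (add_pow_le (by positivity) (by positivity) d).trans ?_
    gcongr
    · norm_num
    · omega
  have h4 : (e ^ a) ^ d ≤ e ^ κ := by
    rw [← Real.rpow_natCast, ← Real.rpow_mul he.le]
    exact Real.rpow_le_rpow_of_exponent_ge he he1 hκ1
  have h5 : (e⁻¹) ^ d * e ^ (p * (γ + 1)) ≤ e ^ κ := by
    have : (e⁻¹) ^ d * e ^ (p * (γ + 1)) = e ^ (p * (γ + 1) - d) := by
      rw [Real.rpow_sub he, Real.rpow_natCast, inv_pow]
      ring
    rw [this]
    exact Real.rpow_le_rpow_of_exponent_ge he he1 hκ2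
  calc _ ≤ e ^ d * (((2 * L + 11) / e) ^ d * (2 ^ d * ((3 * e ^ a) ^ d + (4 * m) ^ d))) := by
        gcongr
    _ = (2 * L + 11) ^ d * 2 ^ d * (3 ^ d * (e ^ a) ^ d + 4 ^ d * m ^ d) := by
        rw [div_pow, mul_pow, mul_pow]
        field_simp
    _ ≤ (2 * L + 11) ^ d * 2 ^ d * (3 ^ d * e ^ κ +
          4 ^ d * ((e⁻¹) ^ d * (2 ^ d * (e ^ (p * (γ + 1)) * s ^ p)))) := by
        gcongr
    _ = (2 * L + 11) ^ d * 2 ^ d * (3 ^ d * e ^ κ +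
          8 ^ d * ((e⁻¹) ^ d * e ^ (p * (γ + 1))) * s ^ p) := by
        have : (8 : ℝ) ^ d = 4 ^ d * 2 ^ d := by rw [← mul_pow]; norm_num
        rw [this]
        ring
    _ ≤ (2 * L + 11) ^ d * 2 ^ d * (3 ^ d * e ^ κ + 8 ^ d * e ^ κ * s ^ p) := by
        gcongr
    _ = _ := by ring

/-- Pairs of points closer than a small power of `ε`, or closer than a multiple of the radius of
the hole of one of them (truncated at a macroscopic length), are negligible in number. -/
lemma IsMarkedPoissonProcess.ae_tendsto_closePairs [IsProbabilityMeasure P]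
    (h : IsMarkedPoissonProcess P lam z ρ) (hlam : 0 ≤ lam) {D : Set (Rd d)}
    (hb : Bornology.IsBounded D) {p a γ : ℝ} (hp0 : 0 < p) (hpd : p ≤ d) (ha : 0 < a)
    (hγ : 0 ≤ γ) (hpγ : (d : ℝ) < p * (γ + 1)) (hp : ∫⁻ ω, ENNReal.ofReal (ρ 0 ω ^ p) ∂P ≠ ∞) :
    ∀ᵐ ω ∂P, Tendsto (fun ε : ℝ => ENNReal.ofReal (ε ^ d) *
      ((closePairs (z · ω) (ρ · ω) (ε⁻¹ • D)
        (fun s => 3 * ε ^ a + 4 * min (ε ^ γ * max s 0) ε⁻¹)).encard : ℝ≥0∞))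
      (𝓝[>] 0) (𝓝 0) := by
  have hd0 : (0 : ℝ) < d := hp0.trans_le hpd
  obtain ⟨L, hL0, hL⟩ := hb.subset_ball_lt 0 (0 : Rd d)
  set κ := min (a * d) (p * (γ + 1) - d)
  have hκ : 0 < κ := lt_min (by positivity) (by linarith)
  set e : ℕ → ℝ := fun k => (1 / 2 : ℝ) ^ k
  have he : ∀ k, 0 < e k := fun k => by positivity
  have he1 : ∀ k, e k ≤ 1 := fun k => pow_le_one₀ (by norm_num) (by norm_num)
  set g : ℕ → ℝ → ℝ := fun k s => 3 * e k ^ a + 4 * min (e k ^ γ * max s 0) (2 / e k)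
  have hg : ∀ k, Measurable (g k) := fun k => by fun_prop
  have hg0 : ∀ k s, 0 < g k s := fun k s => by
    have := he k
    have h2 : 0 ≤ min (e k ^ γ * max s 0) (2 / e k) := le_min (by positivity) (by positivity)
    have h3 : 0 < 3 * e k ^ a := by positivity
    simp only [g]
    linarith
  have hnonneg := h.radius_nonneg 0
  set C : ℝ := lam ^ 2 * 12 ^ d * ((2 * L + 11) ^ d * 2 ^ d)
  refine ae_tendsto_zero_of_dyadic_majorant
    (Y := fun k ω => ENNReal.ofReal (e k ^ d) *
      ((closePairs (z · ω) (ρ · ω) (Metric.ball 0 (2 / e k * L)) (g k)).encard : ℝ≥0∞))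
    (q := (1 / 2 : ℝ) ^ κ)
    (M := ∫⁻ ω, (ENNReal.ofReal (C * 3 ^ d) +
      ENNReal.ofReal (C * 8 ^ d) * ENNReal.ofReal (ρ 0 ω ^ p)) ∂P)
    ?_ (by positivity) (Real.rpow_lt_one (by norm_num) (by norm_num) hκ) ?_ ?_ ?_
  · intro k
    exact ((measurable_encard_setOf (measurableSet_mem_closePairs h measurableSet_ball
      (hg k))).const_mul _).aemeasurable
  · rw [lintegral_add_left measurable_const, lintegral_const,
      lintegral_const_mul' _ _ ENNReal.ofReal_ne_top]
    simp only [measure_univ, mul_one]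
    exact ENNReal.add_ne_top.2 ⟨ENNReal.ofReal_ne_top, ENNReal.mul_ne_top ENNReal.ofReal_ne_top hp⟩
  · intro k
    rw [lintegral_const_mul' _ _ ENNReal.ofReal_ne_top]
    have := h.lintegral_encard_closePairs_le hlam (T := 2 / e k * L)
      (by have := he k; positivity) (hg k) (hg0 k)
    refine (mul_le_mul_right this _).trans ?_
    rw [← lintegral_const_mul' _ _ ENNReal.ofReal_ne_top,
      ← lintegral_const_mul' _ _ ENNReal.ofReal_ne_top]
    refine lintegral_mono_ae ?_
    filter_upwards [hnonneg] with ω hω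
    have hek := (he k).le
    rw [← ENNReal.ofReal_mul (p := C * 8 ^ d) (by positivity),
      ← ENNReal.ofReal_add (by positivity) (by positivity),
      ← ENNReal.ofReal_mul (by positivity), ← ENNReal.ofReal_mul (by positivity)]
    refine ENNReal.ofReal_le_ofReal ?_
    have hc := closePairs_density_le (L := L) hp0 hpd ha (min_le_left _ _ : κ ≤ _)
      (min_le_right _ _) hL0 (he k) (he1 k) hω
    have hq : ((1 / 2 : ℝ) ^ κ) ^ k = e k ^ κ := by
      simp only [e]
      rw [← Real.rpow_natCast, ← Real.rpow_natCast, ← Real.rpow_mul (by norm_num),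
        ← Real.rpow_mul (by norm_num), mul_comm]
    rw [hq]
    simp only [g, max_eq_left hω]
    calc _ = lam ^ 2 * 12 ^ d * (e k ^ d * ((2 / e k * L + (3 * e k ^ a +
            4 * min (e k ^ γ * ρ 0 ω) (2 / e k))) ^ d *
            (3 * e k ^ a + 4 * min (e k ^ γ * ρ 0 ω) (2 / e k)) ^ d)) := by ring
      _ ≤ _ := mul_le_mul_of_nonneg_left hc (by positivity)
      _ = _ := by simp only [C]; ring
  · refine ae_of_all _ fun ω k ε h1 h2 => ?_
    have hε : 0 < ε := lt_trans (by positivity) h1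
    have hinv : ε⁻¹ ≤ 2 / e k := by
      have := inv_le_of_dyadic h1
      simp only [e]
      rwa [one_div, inv_pow, div_inv_eq_mul]
    have hsub : closePairs (z · ω) (ρ · ω) (ε⁻¹ • D)
        (fun s => 3 * ε ^ a + 4 * min (ε ^ γ * max s 0) ε⁻¹) ⊆
        closePairs (z · ω) (ρ · ω) (Metric.ball 0 (2 / e k * L)) (g k) := by
      have hball := inv_smul_subset_ball hε hL (mul_le_mul_of_nonneg_right hinv hL0.le)
      rintro q ⟨hq, hq1, hq2, hq3⟩
      refine ⟨hq, hball hq1, hball hq2, hq3.trans_le ?_⟩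
      simp only [g]
      gcongr
    have hpow : ε ^ d ≤ e k ^ d := by gcongr
    exact mul_le_mul' (ENNReal.ofReal_le_ofReal hpow)
      (by exact_mod_cast Set.encard_le_encard hsub)

end AlmostSure

/-! ### Good points -/

section Good

variable {d : ℕ} {z : ℕ → Rd d} {ρ : ℕ → ℝ} {D : Set (Rd d)} {δ ε : ℝ}

/-- The points of `Φ^ε(D)` whose hole is small and far from all the other holes. The gap is measured
from the boundary of the other hole, so that a good hole stays away from the large holes too. -/
def goodPoints (z : ℕ → Rd d) (ρ : ℕ → ℝ) (D : Set (Rd d)) (δ ε : ℝ) : Set ℕ :=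
  {i | i ∈ pointsIn z D ε ∧ holeRadius d ε (ρ i) ≤ ε ^ (1 + 2 * δ) ∧
    ∀ j ∈ pointsIn z D ε, j ≠ i →
      2 * ε ^ (1 + δ / 2) + holeRadius d ε (ρ j) ≤ ε * dist (z i) (z j)}

lemma goodPoints_subset : goodPoints z ρ D δ ε ⊆ pointsIn z D ε := fun _ hi => hi.1

lemma holeRadius_nonneg {r : ℝ} (hε : 0 < ε) (hr : 0 ≤ r) : 0 ≤ holeRadius d ε r :=
  mul_nonneg (Real.rpow_nonneg hε.le _) hr

lemma holeRadius_rpow {r p : ℝ} (hε : 0 < ε) (hr : 0 ≤ r) :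
    holeRadius d ε r ^ p = ε ^ (p * ((d : ℝ) / ((d : ℝ) - 2))) * r ^ p := by
  rw [holeRadius, Real.mul_rpow (by positivity) hr, ← Real.rpow_mul hε.le, mul_comm p]

lemma dist_smul_pos (hε : 0 < ε) (x y : Rd d) : dist (ε • x) (ε • y) = ε * dist x y := by
  rw [dist_smul₀, Real.norm_of_nonneg hε.le]

lemma lt_dist_of_mem_hole (hδ : 0 < δ) (hε : 0 < ε) (hε1 : ε < 1) {i j : ℕ}
    (hi : i ∈ goodPoints z ρ D δ ε) (hj : j ∈ pointsIn z D ε) (hij : j ≠ i) {x y : Rd d}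
    (hx : x ∈ hole z ρ ε i) (hy : y ∈ hole z ρ ε j) : ε ^ (1 + δ / 2) < dist x y := by
  have h1 := hi.2.2 j hj hij
  have h2 := hi.2.1
  rw [hole, Metric.mem_ball] at hx hy
  rw [← dist_smul_pos hε] at h1
  have h3 := dist_triangle4 (ε • z i) x y (ε • z j)
  rw [dist_comm (ε • z i) x] at h3
  have h4 : ε ^ (1 + 2 * δ) < ε ^ (1 + δ / 2) :=
    Real.rpow_lt_rpow_of_exponent_gt hε hε1 (by linarith)
  linarith

lemma disjoint_hole (hδ : 0 < δ) (hε : 0 < ε) (hε1 : ε < 1) {i j : ℕ}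
    (hi : i ∈ goodPoints z ρ D δ ε) (hj : j ∈ pointsIn z D ε) (hij : j ≠ i) :
    Disjoint (hole z ρ ε i) (hole z ρ ε j) := by
  rw [Set.disjoint_left]
  intro x hx hy
  have := lt_dist_of_mem_hole hδ hε hε1 hi hj hij hx hy
  rw [dist_self] at this
  exact absurd this (not_lt.2 (by positivity))

lemma lt_setEDist_holes (hδ : 0 < δ) (hε : 0 < ε) (hε1 : ε < 1) :
    ENNReal.ofReal (ε ^ (1 + δ)) < setEDist (⋃ i ∈ goodPoints z ρ D δ ε, hole z ρ ε i)
      (⋃ i ∈ pointsIn z D ε \ goodPoints z ρ D δ ε, hole z ρ ε i) := by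
  have h1 : ENNReal.ofReal (ε ^ (1 + δ)) < ENNReal.ofReal (ε ^ (1 + δ / 2)) :=
    (ENNReal.ofReal_lt_ofReal_iff (by positivity)).2
      (Real.rpow_lt_rpow_of_exponent_gt hε hε1 (by linarith))
  refine h1.trans_le (le_iInf₂ fun x hx => le_iInf₂ fun y hy => ?_)
  obtain ⟨i, hi, hx⟩ := mem_iUnion₂.1 hx
  obtain ⟨j, hj, hy⟩ := mem_iUnion₂.1 hy
  have hij : j ≠ i := by
    rintro rfl
    exact hj.2 hi
  rw [edist_dist]
  exact ENNReal.ofReal_le_ofReal (lt_dist_of_mem_hole hδ hε hε1 hi hj.1 hij hx hy).le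

/-! ### Bad points come from large radii or from close pairs -/

/-- The pairs of points in `Φ^ε(D)` that are close in comparison with `ε ^ (δ / 2)` or with the
rescaled radius of the second point. -/
noncomputable def scaledClosePairs (z : ℕ → Rd d) (ρ : ℕ → ℝ) (D : Set (Rd d)) (δ ε : ℝ) :
    Set (ℕ × ℕ) :=
  closePairs z ρ (ε⁻¹ • D) fun s =>
    3 * ε ^ (δ / 2) + 4 * min (ε ^ ((d : ℝ) / ((d : ℝ) - 2) - 1) * max s 0) ε⁻¹

lemma mem_scaledClosePairs (hε : 0 < ε) {i j : ℕ} (hi : i ∈ pointsIn z D ε)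
    (hj : j ∈ pointsIn z D ε) (hij : j ≠ i) (hρ : 0 ≤ ρ j) (h1 : holeRadius d ε (ρ j) ≤ 1)
    (h : ε * dist (z i) (z j) < 3 * ε ^ (1 + δ / 2) + 4 * holeRadius d ε (ρ j)) :
    (i, j) ∈ scaledClosePairs z ρ D δ ε := by
  refine ⟨hij.symm, hi, hj, ?_⟩
  have e1 : ε ^ ((d : ℝ) / ((d : ℝ) - 2) - 1) * max (ρ j) 0 = holeRadius d ε (ρ j) * ε⁻¹ := by
    rw [max_eq_left hρ, Real.rpow_sub_one hε.ne', holeRadius]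
    ring
  have e2 : holeRadius d ε (ρ j) * ε⁻¹ ≤ ε⁻¹ := mul_le_of_le_one_left (by positivity) h1
  simp only
  rw [e1, min_eq_left e2]
  rw [Real.rpow_add hε, Real.rpow_one] at h
  refine lt_of_mul_lt_mul_left (h.trans_le (le_of_eq ?_)) hε.le
  field_simp

lemma bad_subset (hε : 0 < ε) (hρ : ∀ i, 0 ≤ ρ i)
    (h1 : ∀ j ∈ pointsIn z D ε, holeRadius d ε (ρ j) ≤ 1) :
    pointsIn z D ε \ goodPoints z ρ D δ ε ⊆
      {i | i ∈ pointsIn z D ε ∧ ε ^ (1 + 2 * δ) < holeRadius d ε (ρ i)} ∪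
        Prod.fst '' scaledClosePairs z ρ D δ ε := by
  rintro i ⟨hi, hg⟩
  by_cases hb : ε ^ (1 + 2 * δ) < holeRadius d ε (ρ i)
  · exact Or.inl ⟨hi, hb⟩
  right
  by_contra hc
  refine hg ⟨hi, not_lt.1 hb, fun j hj hij => ?_⟩
  by_contra hlt
  refine hc ⟨(i, j), mem_scaledClosePairs hε hi hj hij (hρ j) (h1 j hj) ?_, rfl⟩
  have h2 : 0 ≤ ε ^ (1 + δ / 2) := by positivity
  have h3 := holeRadius_nonneg (d := d) hε (hρ j)
  linarith

lemma thinned_near_bad_subset (hε : 0 < ε) (hρ : ∀ i, 0 ≤ ρ i)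
    (h1 : ∀ j ∈ pointsIn z D ε, holeRadius d ε (ρ j) ≤ 1) {η : ℝ} (hη : 0 < η) :
    {i | i ∈ thinnedPointsIn z D (2 * η) ε ∧
      Metric.infEDist (ε • z i) (⋃ i ∈ pointsIn z D ε \ goodPoints z ρ D δ ε, hole z ρ ε i) ≤
        ENNReal.ofReal (η * ε)} ⊆
      pointsIn z D ε \ goodPoints z ρ D δ ε ∪ Prod.fst '' scaledClosePairs z ρ D δ ε := by
  rintro i ⟨⟨hi, hsep⟩, hd⟩
  have h2 : ENNReal.ofReal (η * ε) < ENNReal.ofReal (3 / 2 * η * ε) :=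
    (ENNReal.ofReal_lt_ofReal_iff (by positivity)).2 (by nlinarith [mul_pos hη hε])
  obtain ⟨y, hy, hxy⟩ := Metric.infEDist_lt_iff.1 (hd.trans_lt h2)
  obtain ⟨j, hj, hy⟩ := mem_iUnion₂.1 hy
  by_cases hij : j = i
  · exact Or.inl (hij ▸ hj)
  · refine Or.inr ⟨(i, j), mem_scaledClosePairs hε hi hj.1 hij (hρ j) (h1 j hj.1) ?_, rfl⟩
    rw [edist_dist, ENNReal.ofReal_lt_ofReal_iff (by positivity)] at hxy
    rw [hole, Metric.mem_ball] at hy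
    have h3 := dist_triangle (ε • z i) y (ε • z j)
    rw [dist_smul_pos hε] at h3
    have h4 : ε * (2 * η) ≤ ε * dist (z i) (z j) := by
      have := hsep j hij
      gcongr
    have h5 : 0 ≤ ε ^ (1 + δ / 2) := by positivity
    -- the hole at `z j` has radius at least `η * ε / 2`, since the two points are `2 * η` apart
    linarith

end Good

/-! ### Asymptotics -/

lemma toReal_encard {ι : Type*} (s : Set ι) : ((s.encard : ℕ∞) : ℝ≥0∞).toReal = s.ncard := by
  rcases s.finite_or_infinite with h | h
  · rw [← h.cast_ncard_eq]
    simp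
  · rw [h.encard_eq, h.ncard]
    simp

lemma tendsto_mul_ncard_of_encard {ι : Type*} {d : ℕ} {S : ℝ → Set ι}
    (h : Tendsto (fun ε : ℝ => ENNReal.ofReal (ε ^ d) * ((S ε).encard : ℝ≥0∞)) (𝓝[>] 0) (𝓝 0)) :
    Tendsto (fun ε : ℝ => ε ^ d * ((S ε).ncard : ℝ)) (𝓝[>] 0) (𝓝 0) := by
  have h1 := (ENNReal.tendsto_toReal ENNReal.zero_ne_top).comp h
  rw [ENNReal.toReal_zero] at h1
  refine h1.congr' ?_
  filter_upwards [self_mem_nhdsWithin] with ε hε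
  have hε' : (0 : ℝ) < ε := hε
  rw [Function.comp, ENNReal.toReal_mul, toReal_encard, ENNReal.toReal_ofReal (by positivity)]

lemma tendsto_encard_of_subset_union {ι : Type*} {d : ℕ} {S A B : ℝ → Set ι}
    (hA : Tendsto (fun ε : ℝ => ENNReal.ofReal (ε ^ d) * ((A ε).encard : ℝ≥0∞)) (𝓝[>] 0) (𝓝 0))
    (hB : Tendsto (fun ε : ℝ => ENNReal.ofReal (ε ^ d) * ((B ε).encard : ℝ≥0∞)) (𝓝[>] 0) (𝓝 0))
    (h : ∀ᶠ ε in 𝓝[>] 0, S ε ⊆ A ε ∪ B ε) :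
    Tendsto (fun ε : ℝ => ENNReal.ofReal (ε ^ d) * ((S ε).encard : ℝ≥0∞)) (𝓝[>] 0) (𝓝 0) := by
  have hAB := hA.add hB
  rw [add_zero] at hAB
  refine tendsto_of_tendsto_of_tendsto_of_le_of_le' tendsto_const_nhds hAB
    (Eventually.of_forall fun _ => zero_le) ?_
  filter_upwards [h] with ε hε
  rw [← mul_add]
  gcongr
  exact_mod_cast (Set.encard_le_encard hε).trans (Set.encard_union_le _ _)

section Asymptotics

variable {d : ℕ} {z : ℕ → Rd d} {ρ : ℕ → ℝ} {D : Set (Rd d)} {δ p : ℝ}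

lemma eventually_holeRadius_le_one (hρ : ∀ i, 0 ≤ ρ i) (hp : 0 < p)
    (h : Tendsto (fun ε : ℝ => ∑' i, (pointsIn z D ε).indicator
      (fun i => ENNReal.ofReal (ε ^ (p * ((d : ℝ) / ((d : ℝ) - 2)))) *
        ENNReal.ofReal (ρ i ^ p)) i) (𝓝[>] 0) (𝓝 0)) :
    ∀ᶠ ε in 𝓝[>] 0, ∀ j ∈ pointsIn z D ε, holeRadius d ε (ρ j) ≤ 1 := by
  filter_upwards [h.eventually_le_const zero_lt_one, self_mem_nhdsWithin] with ε h1 hε j hj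
  have hε' : 0 < ε := hε
  have h2 := (ENNReal.le_tsum j).trans h1
  rw [indicator_of_mem hj, ← ENNReal.ofReal_mul (by positivity), ← holeRadius_rpow hε' (hρ j),
    ENNReal.ofReal_le_one] at h2
  by_contra hlt
  exact absurd h2 (not_le.2 (Real.one_lt_rpow (not_le.1 hlt) hp))

/-- The volume of the holes vanishes, as the radii are eventually at most `1` and `p ≤ d`. -/
lemma tendsto_volume_holes (hd : 2 < d) (hρ : ∀ i, 0 ≤ ρ i) (hp : 0 < p) (hpd : p ≤ d)
    (h : Tendsto (fun ε : ℝ => ∑' i, (pointsIn z D ε).indicator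
      (fun i => ENNReal.ofReal (ε ^ (p * ((d : ℝ) / ((d : ℝ) - 2)))) *
        ENNReal.ofReal (ρ i ^ p)) i) (𝓝[>] 0) (𝓝 0)) :
    Tendsto (fun ε => volume (holes z ρ D ε)) (𝓝[>] 0) (𝓝 0) := by
  have : Nonempty (Fin d) := ⟨⟨0, by omega⟩⟩
  have h2 := ENNReal.Tendsto.mul_const (b := volume (Metric.ball (0 : Rd d) 1)) h
    (Or.inr measure_ball_lt_top.ne)
  rw [zero_mul] at h2
  refine tendsto_of_tendsto_of_tendsto_of_le_of_le' tendsto_const_nhds h2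
    (Eventually.of_forall fun _ => zero_le) ?_
  filter_upwards [eventually_holeRadius_le_one hρ hp h, self_mem_nhdsWithin] with ε h1 hε
  have hε' : 0 < ε := hε
  refine (measure_biUnion_le _ (Set.to_countable _) _).trans ?_
  rw [tsum_subtype (pointsIn z D ε) fun i => volume (hole z ρ ε i), ← ENNReal.tsum_mul_right]
  refine ENNReal.tsum_le_tsum fun i => ?_
  by_cases hi : i ∈ pointsIn z D ε
  · have h3 := holeRadius_nonneg (d := d) hε' (hρ i)
    rw [indicator_of_mem hi, indicator_of_mem hi, hole, Measure.addHaar_ball _ _ h3,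
      finrank_euclideanSpace_fin, ← ENNReal.ofReal_mul (by positivity),
      ← holeRadius_rpow hε' (hρ i)]
    gcongr
    rcases h3.eq_or_lt with h0 | h0
    · rw [← h0, Real.zero_rpow hp.ne', zero_pow (by omega)]
    · rw [← Real.rpow_natCast]
      exact Real.rpow_le_rpow_of_exponent_ge h0 (h1 i hi) hpd
  · rw [indicator_of_notMem hi]
    exact zero_le

/-- Markov's inequality bounds the number of large holes by the sum of powers of the radii. -/
lemma tendsto_encard_large (hρ : ∀ i, 0 ≤ ρ i) (hp : 0 < p)
    (h : Tendsto (fun ε : ℝ => ∑' i, (pointsIn z D ε).indicator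
      (fun i => ENNReal.ofReal (ε ^ ((d : ℝ) + p * ((d : ℝ) / ((d : ℝ) - 2) - (1 + 2 * δ)))) *
        ENNReal.ofReal (ρ i ^ p)) i) (𝓝[>] 0) (𝓝 0)) :
    Tendsto (fun ε : ℝ => ENNReal.ofReal (ε ^ d) *
      (({i | i ∈ pointsIn z D ε ∧ ε ^ (1 + 2 * δ) < holeRadius d ε (ρ i)} : Set ℕ).encard : ℝ≥0∞))
      (𝓝[>] 0) (𝓝 0) := by
  refine tendsto_of_tendsto_of_tendsto_of_le_of_le' tendsto_const_nhds h
    (Eventually.of_forall fun _ => zero_le) ?_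
  filter_upwards [self_mem_nhdsWithin] with ε hε
  have hε' : 0 < ε := hε
  rw [← tsum_indicator_one_eq_encard, ← ENNReal.tsum_mul_left]
  refine ENNReal.tsum_le_tsum fun i => ?_
  by_cases hi : i ∈ pointsIn z D ε ∧ ε ^ (1 + 2 * δ) < holeRadius d ε (ρ i)
  · rw [indicator_of_mem hi.1, indicator_of_mem (by exact hi), mul_one,
      ← ENNReal.ofReal_mul (by positivity)]
    refine ENNReal.ofReal_le_ofReal ?_
    have h1 : (ε ^ (1 + 2 * δ)) ^ p ≤ holeRadius d ε (ρ i) ^ p := by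
      have := hi.2.le
      gcongr
    rw [holeRadius_rpow hε' (hρ i), ← Real.rpow_mul hε'.le] at h1
    have e : ε ^ ((d : ℝ) + p * ((d : ℝ) / ((d : ℝ) - 2) - (1 + 2 * δ))) =
        ε ^ d * (ε ^ (p * ((d : ℝ) / ((d : ℝ) - 2))) / ε ^ ((1 + 2 * δ) * p)) := by
      rw [← Real.rpow_natCast, ← Real.rpow_sub hε', ← Real.rpow_add hε']
      congr 1
      ring
    have h2 : 0 < ε ^ ((1 + 2 * δ) * p) := by positivity
    rw [e, mul_assoc]
    refine le_mul_of_one_le_right (by positivity) ?_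
    rw [div_mul_eq_mul_div, one_le_div h2]
    exact h1
  · rw [indicator_of_notMem (by exact hi), mul_zero]
    exact zero_le

end Asymptotics

/-! ### The partition of the holes -/

theorem lemma3p1 (d : ℕ) (hd : 2 < d) (β : ℝ) (hβ : 0 < β) :
    ∃ δ : ℝ, 0 < δ ∧
      ∀ (Ω : Type*) [MeasurableSpace Ω] (P : Measure Ω) [IsProbabilityMeasure P]
        (lam : ℝ) (_ : 0 < lam) (z : ℕ → Ω → Rd d) (ρ : ℕ → Ω → ℝ)
        (_ : IsMarkedPoissonProcess P lam z ρ)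
        (_ : Integrable (fun ω => ρ 0 ω ^ ((d : ℝ) - 2 + β)) P)
        (D : Set (Rd d)) (_ : IsOpen D) (_ : Bornology.IsBounded D) (_ : StarConvex ℝ 0 D),
      ∀ᵐ ω ∂P,
        ∃ (n : ℝ → Set ℕ) (Hg Hb Db : ℝ → Set (Rd d)),
          (∃ ε₀ : ℝ, 0 < ε₀ ∧ ∀ ε : ℝ, 0 < ε → ε ≤ ε₀ →
            -- the partition of the holes
            holes (z · ω) (ρ · ω) D ε = Hg ε ∪ Hb ε ∧
            Disjoint (Hg ε) (Hb ε) ∧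
            n ε ⊆ pointsIn (z · ω) D ε ∧
            Hg ε = (⋃ i ∈ n ε, hole (z · ω) (ρ · ω) ε i) ∧
            Hb ε = (⋃ i ∈ pointsIn (z · ω) D ε \ n ε, hole (z · ω) (ρ · ω) ε i) ∧
            -- the safety layer
            MeasurableSet (Db ε) ∧
            Hb ε ⊆ Db ε ∧
            ENNReal.ofReal (ε ^ (1 + δ)) < setEDist (Hg ε) (Db ε) ∧
            -- the good holes
            (n ε).PairwiseDisjoint (hole (z · ω) (ρ · ω) ε) ∧
            (∀ i ∈ n ε, ∀ j ∈ n ε, i ≠ j → 2 * ε ^ (1 + δ / 2) ≤ ε * dist (z i ω) (z j ω)) ∧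
            (∀ i ∈ n ε, holeRadius d ε (ρ i ω) ≤ ε ^ (1 + 2 * δ))) ∧
          Tendsto (fun ε => volume (Db ε)) (𝓝[>] 0) (𝓝 0) ∧
          Tendsto (fun ε : ℝ => ε ^ d * ((n ε).ncard : ℝ)) (𝓝[>] 0)
            (𝓝 (lam * (volume : Measure (Rd d)).real D)) ∧
          ∀ η : ℝ, 0 < η →
            Tendsto (fun ε : ℝ => ε ^ d *
              ({i | i ∈ thinnedPointsIn (z · ω) D (2 * η) ε ∧
                Metric.infEDist (ε • z i ω) (Db ε) ≤ ENNReal.ofReal (η * ε)}.ncard : ℝ))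
              (𝓝[>] 0) (𝓝 0) := by
  have hd2 : (0 : ℝ) < (d : ℝ) - 2 := by
    have : (2 : ℝ) < d := by exact_mod_cast hd
    linarith
  -- any `δ < 1 / (d - 2)` makes the threshold `ε ^ (1 + 2 δ)` larger than `ε ^ (d / (d - 2))`
  set δ : ℝ := 1 / (2 * ((d : ℝ) - 2))
  have hδ : 0 < δ := by positivity
  refine ⟨δ, hδ, ?_⟩
  intro Ω _ P _ lam hlam z ρ h hint D hDo hDb hDs
  -- the moment may be lowered to an exponent `p ∈ (d - 2, d]`
  set p : ℝ := (d : ℝ) - 2 + min β 2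
  have hm : 0 < min β 2 := lt_min hβ two_pos
  have hm2 : min β 2 ≤ 2 := min_le_right _ _
  have hp2 : (d : ℝ) - 2 < p := by simp only [p]; linarith
  have hp0 : 0 < p := hd2.trans hp2
  have hpd : p ≤ d := by simp only [p]; linarith
  have hpint : ∫⁻ ω, ENNReal.ofReal (ρ 0 ω ^ p) ∂P ≠ ∞ := by
    refine ne_top_of_le_ne_top (((integrable_const (1 : ℝ)).add hint).lintegral_lt_top.ne) ?_
    refine lintegral_mono_ae ?_
    filter_upwards [h.radius_nonneg 0] with ω hω
    refine ENNReal.ofReal_le_ofReal ?_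
    simp only [Pi.add_apply]
    rcases le_total (ρ 0 ω) 1 with h1 | h1
    · exact (Real.rpow_le_one hω h1 hp0.le).trans (le_add_of_nonneg_right (by positivity))
    · refine (Real.rpow_le_rpow_of_exponent_le h1 ?_).trans (le_add_of_nonneg_left zero_le_one)
      simp only [p]
      gcongr
      exact min_le_left _ _
  have hpq : (d : ℝ) < p * ((d : ℝ) / ((d : ℝ) - 2)) := by
    rw [← mul_div_assoc, lt_div_iff₀ hd2, mul_comm]
    have : (0 : ℝ) < d := by linarith
    gcongr
  have hκ : 0 < p * ((d : ℝ) / ((d : ℝ) - 2) - (1 + 2 * δ)) := by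
    have : (d : ℝ) / ((d : ℝ) - 2) - (1 + 2 * δ) = 1 / ((d : ℝ) - 2) := by
      simp only [δ]
      field_simp
      ring
    rw [this]
    positivity
  have hγ : 0 ≤ (d : ℝ) / ((d : ℝ) - 2) - 1 := by
    rw [sub_nonneg, one_le_div hd2]
    linarith
  filter_upwards [h.ae_finite, ae_all_iff.2 h.radius_nonneg,
    h.ae_tendsto_ncard_pointsIn hlam.le (by omega) hDo.measurableSet hDb hDs,
    h.ae_tendsto_tsum_radius hlam.le hDb (sub_pos.2 hpq) hpint,
    h.ae_tendsto_tsum_radius hlam.le hDb hκ hpint,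
    h.ae_tendsto_closePairs hlam.le hDb hp0 hpd (half_pos hδ) hγ (by rwa [sub_add_cancel]) hpint]
    with ω hfin hρ hN hsum hlarge hpairs
  simp only [add_sub_cancel] at hsum
  have hR1 := eventually_holeRadius_le_one hρ hp0 hsum
  have hpos : ∀ᶠ ε : ℝ in 𝓝[>] 0, 0 < ε := self_mem_nhdsWithin
  set n : ℝ → Set ℕ := goodPoints (z · ω) (ρ · ω) D δ
  set Hg : ℝ → Set (Rd d) := fun ε => ⋃ i ∈ n ε, hole (z · ω) (ρ · ω) ε i
  set Hb : ℝ → Set (Rd d) := fun ε => ⋃ i ∈ pointsIn (z · ω) D ε \ n ε, hole (z · ω) (ρ · ω) ε i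
  have hpairs1 : Tendsto (fun ε : ℝ => ENNReal.ofReal (ε ^ d) *
      ((Prod.fst '' scaledClosePairs (z · ω) (ρ · ω) D δ ε).encard : ℝ≥0∞)) (𝓝[>] 0) (𝓝 0) := by
    refine tendsto_of_tendsto_of_tendsto_of_le_of_le tendsto_const_nhds hpairs
      (fun _ => zero_le) fun ε => ?_
    refine mul_le_mul_right ?_ _
    exact ENat.toENNReal_le.2 (Set.encard_image_le _ _)
  have hbad : Tendsto (fun ε : ℝ => ENNReal.ofReal (ε ^ d) *
      ((pointsIn (z · ω) D ε \ n ε).encard : ℝ≥0∞)) (𝓝[>] 0) (𝓝 0) := by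
    refine tendsto_encard_of_subset_union (tendsto_encard_large hρ hp0 hlarge) hpairs1 ?_
    filter_upwards [hR1, hpos] with ε h1 hε
    exact bad_subset hε hρ h1
  -- all the conditions on the safety layer are monotone in it, so that the smallest one, `Hb`
  -- itself, is the best choice
  refine ⟨n, Hg, Hb, Hb, ⟨1 / 2, by norm_num, fun ε hε hε2 => ?_⟩, ?_, ?_, fun η hη => ?_⟩
  · have hε1 : ε < 1 := by linarith
    refine ⟨?_, ?_, goodPoints_subset, rfl, rfl, ?_, subset_rfl, lt_setEDist_holes hδ hε hε1,
      ?_, ?_, fun i hi => hi.2.1⟩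
    · simp only [Hg, Hb, holes]
      rw [← biUnion_union, union_sdiff_cancel goodPoints_subset]
    · simp only [Hg, Hb, disjoint_iUnion_left, disjoint_iUnion_right]
      intro i hi j hj
      refine disjoint_hole hδ hε hε1 hj hi.1 ?_
      rintro rfl
      exact hi.2 hj
    · exact (isOpen_biUnion fun i _ => Metric.isOpen_ball).measurableSet
    · intro i hi j hj hij
      exact disjoint_hole hδ hε hε1 hi hj.1 hij.symm
    · intro i hi j hj hij
      have h1 := hi.2.2 j hj.1 hij.symm
      have h2 := holeRadius_nonneg (d := d) hε (hρ j)
      linarith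
  · refine tendsto_of_tendsto_of_tendsto_of_le_of_le tendsto_const_nhds
      (tendsto_volume_holes hd hρ hp0 hpd hsum) (fun _ => zero_le) fun ε => measure_mono ?_
    exact biUnion_subset_biUnion_left sdiff_subset
  · have h1 := hN.sub (tendsto_mul_ncard_of_encard hbad)
    rw [sub_zero] at h1
    refine h1.congr fun ε => ?_
    have h2 := Set.ncard_sdiff_add_ncard_of_subset
      (goodPoints_subset (z := (z · ω)) (ρ := (ρ · ω)) (D := D) (δ := δ) (ε := ε))
      (hfin _ (hDb.smul₀ ε⁻¹))
    rw [← mul_sub]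
    congr 1
    rw [sub_eq_iff_eq_add, add_comm]
    exact_mod_cast h2.symm
  · refine tendsto_mul_ncard_of_encard (tendsto_encard_of_subset_union hbad hpairs1 ?_)
    filter_upwards [hR1, hpos] with ε h1 hε
    exact thinned_near_bad_subset hε hρ h1 hη
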